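/- Let $m\ge 1$, let $\mu_j,\gamma_j\in\mathbb R$ and $\sigma_j>0$ for $1\le j\le m$. For subjects $h=1,2,\dots$ let $\alpha_h\sim N(0,1)$ and let $Y_{\cdot h}=(Y_{1h},\dots,Y_{mh})$ (fully observed, all weights $w_{jh}=1$) be such that, given $\alpha_h$, the $Y_{jh}$ are independent with $Y_{jh}\mid\alpha_h\sim N(\mu_j+\gamma_j\alpha_h,\sigma_j^2)$, and let the pairs $(\alpha_h,Y_{\cdot h})$, $h\ge1$, be independent. Write $\varphi(x;\mu,\sigma^2)$ for the density of $N(\mu,\sigma^2)$ at $x$, and let $$\mathrm{NMLL}_h=-\log\int_{\mathbb R}\varphi(a;0,1)\prod_{j=1}^m\varphi(Y_{jh};\mu_j+\gamma_ja,\sigma_j^2)\,da,\qquad \mathrm{ENMLL}_H=\frac1H\sum_{h=1}^H\mathrm{NMLL}_h,$$ $$L=\frac12\log\Big[\Big(1+\sum_{j=1}^m\frac{\gamma_j^2}{\sigma_j^2}\Big)\prod_{j=1}^m\sigma_j^2\Big]+\frac m2(\log 2\pi+1).$$ Then $\mathrm{NMLL}_h$ is integrable with $E[\mathrm{NMLL}_h]=L$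 for every $h$, and $$\mathrm{ENMLL}_H\longrightarrow L\quad\text{almost surely as }H\to\infty.$$ Moreover there is $v\in(0,\infty)$ such that every $\mathrm{NMLL}_h$ is square integrable with variance $v$, such that $\frac1H\sum_{h=1}^H(\mathrm{NMLL}_h-\mathrm{ENMLL}_H)^2\to v$ almost surely, and such that $$\sqrt H\,\big(\mathrm{ENMLL}_H-L\big)\longrightarrow N(0,v)\quad\text{in distribution as }H\to\infty.$$ -/

import Mathlib

open MeasureTheory ProbabilityTheory Filter Topology
open scoped NNReal

namespace FactorModel

/-- The conditional law of the indicator vector `(Y_1, …, Y_m)` of one subject given the value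
`α = a` of its latent factor: the coordinates are independent and the `j`-th one is
`N(μ_j + γ_j a, σ_j ^ 2)`. -/
noncomputable def condLaw {m : ℕ} (μ γ σ : Fin m → ℝ) (a : ℝ) : Measure (Fin m → ℝ) :=
  Measure.pi fun j => gaussianReal (μ j + γ j * a) (Real.toNNReal (σ j ^ 2))

theorem measurable_condLaw {m : ℕ} (μ γ σ : Fin m → ℝ) : Measurable (condLaw μ γ σ) := by
  have hprob : ∀ a, IsProbabilityMeasure (condLaw μ γ σ a) := fun a => by
    unfold condLaw; infer_instance
  refine Measurable.measure_of_isPiSystem_of_isProbabilityMeasure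
    (S := Set.pi Set.univ '' Set.pi Set.univ fun _ : Fin m => {s : Set ℝ | MeasurableSet s})
    generateFrom_pi.symm isPiSystem_pi ?_
  rintro _ ⟨s, hs, rfl⟩
  have hs' : ∀ j, MeasurableSet (s j) := fun j => hs j (Set.mem_univ j)
  simp only [condLaw, Measure.pi_pi]
  refine Finset.measurable_prod _ fun j _ => ?_
  have hg : Measurable fun a : ℝ => gaussianReal (μ j + γ j * a) (Real.toNNReal (σ j ^ 2)) :=
    measurable_gaussianReal.comp (by fun_prop :
      Measurable fun a : ℝ => (μ j + γ j * a, Real.toNNReal (σ j ^ 2)))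
  exact (Measure.measurable_coe (hs' j)).comp hg

/-- `condLaw` as a Markov kernel from the latent factor to the vector of indicators. -/
noncomputable def condKernel {m : ℕ} (μ γ σ : Fin m → ℝ) : Kernel ℝ (Fin m → ℝ) where
  toFun := condLaw μ γ σ
  measurable' := measurable_condLaw μ γ σ

instance isMarkovKernel_condKernel {m : ℕ} (μ γ σ : Fin m → ℝ) :
    IsMarkovKernel (condKernel μ γ σ) :=
  ⟨fun a => by
    change IsProbabilityMeasure (condLaw μ γ σ a)
    unfold condLaw
    infer_instance⟩

/-- The single-factor model for the subjects `h = 0, 1, 2, …`, with latent factors `α h` and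
fully observed indicator vectors `Y h`: the latent factor is standard normal; given `α h` the
indicators `Y h · j` are independent with laws `N(μ_j + γ_j α_h, σ_j ^ 2)`; and the subjects are
independent of each other. -/
structure IsSingleFactorModel {Ω : Type*} [MeasurableSpace Ω] (P : Measure Ω) {m : ℕ}
    (μ γ σ : Fin m → ℝ) (α : ℕ → Ω → ℝ) (Y : ℕ → Ω → Fin m → ℝ) : Prop where
  hasLaw_latent : ∀ h, HasLaw (α h) (gaussianReal 0 1) P
  hasCondDistrib : ∀ h, HasCondDistrib (Y h) (α h) (condKernel μ γ σ) P
  iIndepFun_subjects : iIndepFun (fun h ω => (α h ω, Y h ω)) P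

/-- The joint density of the latent factor and the indicators of one subject, at `(a, y)`. -/
noncomputable def jointDensity {m : ℕ} (μ γ σ : Fin m → ℝ) (a : ℝ) (y : Fin m → ℝ) : ℝ :=
  gaussianPDFReal 0 1 a *
    ∏ j, gaussianPDFReal (μ j + γ j * a) (Real.toNNReal (σ j ^ 2)) (y j)

/-- The marginal likelihood of the parameters at the indicators `y` of one subject: the latent
factor is integrated out of the joint density. -/
noncomputable def marginalLikelihood {m : ℕ} (μ γ σ : Fin m → ℝ) (y : Fin m → ℝ) : ℝ :=
  ∫ a, jointDensity μ γ σ a y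

/-- The negative marginal log-likelihood of one subject. -/
noncomputable def nmll {m : ℕ} (μ γ σ : Fin m → ℝ) (y : Fin m → ℝ) : ℝ :=
  -Real.log (marginalLikelihood μ γ σ y)

/-- The average negative marginal log-likelihood of the first `H` subjects. -/
noncomputable def avgNmll {Ω : Type*} {m : ℕ} (μ γ σ : Fin m → ℝ) (Y : ℕ → Ω → Fin m → ℝ)
    (H : ℕ) (ω : Ω) : ℝ :=
  (1 / (H : ℝ)) * ∑ h ∈ Finset.range H, nmll μ γ σ (Y h ω)

/-- The number `½ log [(1 + ∑ γ_j²/σ_j²) ∏ σ_j²] + (m/2) (log 2π + 1)`. -/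
noncomputable def limitValue {m : ℕ} (γ σ : Fin m → ℝ) : ℝ :=
  1 / 2 * Real.log ((1 + ∑ j, γ j ^ 2 / σ j ^ 2) * ∏ j, σ j ^ 2) +
    (m : ℝ) / 2 * (Real.log (2 * Real.pi) + 1)

end FactorModel

/-! The integrand defining the marginal likelihood is the exponential of a quadratic in the latent
variable, so completing the square gives a closed form (`nmll_eq`): the NMLL is `L - m/2 + Q/2`.
With `c_j = γ_j/σ_j` and `x` the standardised indicators, `Q = |x|² - (c·x)²/(1+|c|²)`, which is
`xᵀ(I + ccᵀ)⁻¹x` by Sherman–Morrison.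

Under the model `x = cα + z` with `α, z_1, …, z_m` independent standard normals, so `Q` combines
squares of linear forms in this noise. Second moments give `E[Q] = m`, hence mean `L`
(`integral_marginalQuadratic_noise`); fourth moments make `Q` square integrable; and `Q` is
continuous and nonconstant while the noise has full support, so `v > 0`.

The subjects' NMLLs are therefore i.i.d. with finite positive variance. The strong law, applied to
them and to their squares, and the central limit theorem give the limits. -/

namespace FactorModel

/-! ### Closed form of the marginal likelihood -/

section ClosedForm

variable {m : ℕ} (μ γ σ : Fin m → ℝ)

/-- The integral of a quadratic exponential, by completing the square. -/
theorem integral_exp_neg_half_quadratic {s : ℝ} (hs : 0 < s) (t q : ℝ) :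
    ∫ a : ℝ, Real.exp (-(s * a ^ 2 - 2 * t * a + q) / 2) =
      √(2 * Real.pi / s) * Real.exp (-(q - t ^ 2 / s) / 2) := by
  have h : ∀ a : ℝ, Real.exp (-(s * a ^ 2 - 2 * t * a + q) / 2) =
      Real.exp (-(s / 2) * (a - t / s) ^ 2) * Real.exp (-(q - t ^ 2 / s) / 2) := fun a => by
    rw [← Real.exp_add]
    congr 1
    field_simp
    ring
  simp_rw [h]
  rw [integral_mul_const, integral_sub_right_eq_self (fun a => Real.exp (-(s / 2) * a ^ 2)),
    integral_gaussian]
  congr 2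
  field_simp

/-- The quadratic form in the standardised indicators `x` that appears in the exponent of the
marginal density with standardised loadings `c`. -/
noncomputable def marginalQuadratic (c x : Fin m → ℝ) : ℝ :=
  ∑ j, x j ^ 2 - (∑ j, c j * x j) ^ 2 / (1 + ∑ j, c j ^ 2)

variable {σ}

theorem jointDensity_eq (hσ : ∀ j, 0 < σ j) (a : ℝ) (y : Fin m → ℝ) :
    jointDensity μ γ σ a y =
      ((√(2 * Real.pi))⁻¹ * ∏ j, (√(2 * Real.pi * σ j ^ 2))⁻¹) *
        Real.exp (-((1 + ∑ j, (γ j / σ j) ^ 2) * a ^ 2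
          - 2 * (∑ j, γ j / σ j * ((y j - μ j) / σ j)) * a
          + ∑ j, ((y j - μ j) / σ j) ^ 2) / 2) := by
  simp only [jointDensity, gaussianPDFReal, Real.coe_toNNReal _ (sq_nonneg _)]
  rw [Finset.prod_mul_distrib, ← Real.exp_sum]
  have hexp : -((1 + ∑ j, (γ j / σ j) ^ 2) * a ^ 2
          - 2 * (∑ j, γ j / σ j * ((y j - μ j) / σ j)) * a
          + ∑ j, ((y j - μ j) / σ j) ^ 2) / 2 =
      -(a - 0) ^ 2 / (2 * ((1 : ℝ≥0) : ℝ)) +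
        ∑ j, -(y j - (μ j + γ j * a)) ^ 2 / (2 * σ j ^ 2) := by
    have h : ∀ j, -(y j - (μ j + γ j * a)) ^ 2 / (2 * σ j ^ 2) =
        -(a ^ 2 / 2) * (γ j / σ j) ^ 2 + a * (γ j / σ j * ((y j - μ j) / σ j))
          - (1 / 2) * ((y j - μ j) / σ j) ^ 2 := fun j => by
      have := (hσ j).ne'
      field_simp
      ring
    simp_rw [h, Finset.sum_sub_distrib, Finset.sum_add_distrib, ← Finset.mul_sum]
    push_cast
    ring
  rw [hexp, Real.exp_add]
  simp only [NNReal.coe_one, mul_one]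
  ring

theorem marginalLikelihood_eq (hσ : ∀ j, 0 < σ j) (y : Fin m → ℝ) :
    marginalLikelihood μ γ σ y =
      (∏ j, (√(2 * Real.pi * σ j ^ 2))⁻¹) * (√(1 + ∑ j, (γ j / σ j) ^ 2))⁻¹ *
        Real.exp (-marginalQuadratic (fun j => γ j / σ j) (fun j => (y j - μ j) / σ j) / 2) := by
  have hs : 0 < 1 + ∑ j, (γ j / σ j) ^ 2 := by positivity
  simp_rw [marginalLikelihood, jointDensity_eq μ γ hσ, integral_const_mul,
    integral_exp_neg_half_quadratic hs, marginalQuadratic]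
  rw [Real.sqrt_div (by positivity)]
  have : √(2 * Real.pi) ≠ 0 := by positivity
  field_simp

/-- All randomness sits in the quadratic form. The constant is written through `limitValue` so that
the mean claim reduces to the quadratic form having mean `m`. -/
theorem nmll_eq (hσ : ∀ j, 0 < σ j) (y : Fin m → ℝ) :
    nmll μ γ σ y = limitValue γ σ - (m : ℝ) / 2 +
      marginalQuadratic (fun j => γ j / σ j) (fun j => (y j - μ j) / σ j) / 2 := by
  have hs : 0 < 1 + ∑ j, (γ j / σ j) ^ 2 := by positivity
  have hσ0 : ∀ j, σ j ^ 2 ≠ 0 := fun j => by have := hσ j; positivity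
  have hprod : ∏ j, (√(2 * Real.pi * σ j ^ 2))⁻¹ ≠ 0 :=
    Finset.prod_ne_zero_iff.2 fun j _ => by have := hσ j; positivity
  have hlog : ∀ j, Real.log (√(2 * Real.pi * σ j ^ 2))⁻¹ =
      -(Real.log (2 * Real.pi) / 2) - Real.log (σ j ^ 2) / 2 := fun j => by
    rw [Real.log_inv, Real.log_sqrt (by positivity), Real.log_mul (by positivity) (hσ0 j)]
    ring
  rw [nmll, marginalLikelihood_eq μ γ hσ, Real.log_mul (mul_ne_zero hprod (by positivity))
    (Real.exp_ne_zero _), Real.log_mul hprod (by positivity), Real.log_exp, Real.log_inv,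
    Real.log_sqrt hs.le, Real.log_prod fun j _ => by have := hσ j; positivity, limitValue]
  simp_rw [hlog, ← div_pow]
  rw [Real.log_mul hs.ne' (Finset.prod_ne_zero_iff.2 fun j _ => hσ0 j),
    Real.log_prod fun j _ => hσ0 j, Finset.sum_sub_distrib, ← Finset.sum_div]
  simp only [Finset.sum_const, Finset.card_univ, Fintype.card_fin, nsmul_eq_mul]
  ring

end ClosedForm

/-! ### Reduction to independent standard normal noise -/

section Law

variable {m : ℕ} (μ γ σ : Fin m → ℝ)

/-- The law of the standardised noise: one latent factor and `m` residuals, all independent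
standard normal. -/
noncomputable def noiseLaw (m : ℕ) : Measure (ℝ × (Fin m → ℝ)) :=
  (gaussianReal 0 1).prod (Measure.pi fun _ => gaussianReal 0 1)

instance isProbabilityMeasure_noiseLaw (m : ℕ) : IsProbabilityMeasure (noiseLaw m) := by
  unfold noiseLaw; infer_instance

/-- The indicators as a function of the latent factor and the standardised residuals. -/
def indicators (p : ℝ × (Fin m → ℝ)) : Fin m → ℝ := fun j => μ j + γ j * p.1 + σ j * p.2 j

theorem measurable_indicators : Measurable (indicators μ γ σ) := by
  unfold indicators; fun_prop

theorem condLaw_eq_map (a : ℝ) :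
    condLaw μ γ σ a =
      (Measure.pi fun _ => gaussianReal 0 1).map fun z => indicators μ γ σ (a, z) := by
  have h : ∀ j, gaussianReal (μ j + γ j * a) (Real.toNNReal (σ j ^ 2)) =
      (gaussianReal 0 1).map fun x => μ j + γ j * a + σ j * x := fun j => by
    have : (fun x => μ j + γ j * a + σ j * x) =
        (fun x => μ j + γ j * a + x) ∘ (fun x => σ j * x) := rfl
    rw [this, ← Measure.map_map (by fun_prop) (by fun_prop), gaussianReal_map_const_mul,
      gaussianReal_map_const_add]
    congr 1
    · ring
    · ext; simp [sq_nonneg]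
  simp_rw [condLaw, h]
  have hp : ∀ j, IsProbabilityMeasure
      ((gaussianReal 0 1).map fun x => μ j + γ j * a + σ j * x) := fun j => by
    rw [← h j]; infer_instance
  exact (Measure.pi_map_pi fun j => by fun_prop).symm

/-- Moments of one subject's indicators can thus be computed on a fixed product space: the law of `Y
h` is the second marginal of latent law and kernel, and each conditional law is an affine image of
standard normals. -/
theorem IsSingleFactorModel.map_eq {Ω : Type*} [MeasurableSpace Ω] {P : Measure Ω}
    [IsProbabilityMeasure P] {μ γ σ : Fin m → ℝ} {α : ℕ → Ω → ℝ} {Y : ℕ → Ω → Fin m → ℝ}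
    (hmodel : IsSingleFactorModel P μ γ σ α Y) (h : ℕ) :
    P.map (Y h) = (noiseLaw m).map (indicators μ γ σ) := by
  have hpair := ((hmodel.hasLaw_latent h).prodMk_of_hasCondDistrib (hmodel.hasCondDistrib h))
  rw [← Measure.snd_map_prodMk₀ (hmodel.hasCondDistrib h).aemeasurable_fst, hpair.map_eq,
    Measure.snd_compProd]
  ext s hs
  rw [Measure.bind_apply hs (Kernel.aemeasurable _),
    Measure.map_apply (measurable_indicators μ γ σ) hs, noiseLaw, Measure.prod_apply (measurable_indicators μ γ σ hs)]
  refine lintegral_congr fun a => ?_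
  change condLaw μ γ σ a s = _
  rw [condLaw_eq_map, Measure.map_apply _ hs]
  · rfl
  · exact (measurable_indicators μ γ σ).comp (by fun_prop)

end Law

/-! ### Moments and nondegeneracy of the quadratic form -/

section Moments

open scoped ENNReal

variable {m : ℕ}

instance isOpenPosMeasure_gaussianReal : (gaussianReal 0 1).IsOpenPosMeasure :=
  (gaussianReal_absolutelyContinuous' 0 one_ne_zero).isOpenPosMeasure

instance isOpenPosMeasure_noiseLaw (m : ℕ) : (noiseLaw m).IsOpenPosMeasure := by
  unfold noiseLaw; infer_instance

/-- A linear form in the noise. -/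
def noiseForm (b : ℝ) (d : Fin m → ℝ) (p : ℝ × (Fin m → ℝ)) : ℝ := b * p.1 + ∑ j, d j * p.2 j

theorem memLp_noiseForm (b : ℝ) (d : Fin m → ℝ) {q : ℝ≥0∞} (hq : q ≠ ∞) :
    MemLp (noiseForm b d) q (noiseLaw m) := by
  have h1 : MemLp (fun p : ℝ × (Fin m → ℝ) => p.1) q (noiseLaw m) :=
    (memLp_id_gaussianReal' q hq).comp_measurePreserving measurePreserving_fst
  have h2 : ∀ j, MemLp (fun p : ℝ × (Fin m → ℝ) => p.2 j) q (noiseLaw m) := fun j =>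
    (memLp_id_gaussianReal' q hq).comp_measurePreserving
      ((measurePreserving_eval (fun _ : Fin m => gaussianReal 0 1) j).comp measurePreserving_snd)
  exact (h1.const_mul b).add (memLp_finsetSum _ fun j _ => (h2 j).const_mul (d j))

theorem integral_noiseForm (b : ℝ) (d : Fin m → ℝ) : ∫ p, noiseForm b d p ∂noiseLaw m = 0 := by
  have h1 : MeasurePreserving (fun p : ℝ × (Fin m → ℝ) => p.1) (noiseLaw m) (gaussianReal 0 1) :=
    measurePreserving_fst
  have h2 : ∀ j, MeasurePreserving (fun p : ℝ × (Fin m → ℝ) => p.2 j) (noiseLaw m)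
      (gaussianReal 0 1) := fun j =>
    (measurePreserving_eval (fun _ : Fin m => gaussianReal 0 1) j).comp measurePreserving_snd
  have hid : Integrable id (gaussianReal 0 1) :=
    memLp_one_iff_integrable.1 (memLp_id_gaussianReal' 1 (by simp))
  have e1 : ∫ p : ℝ × (Fin m → ℝ), p.1 ∂noiseLaw m = 0 := by
    have := h1.hasLaw.integral_eq
    simpa using this
  have e2 : ∀ j, ∫ p : ℝ × (Fin m → ℝ), p.2 j ∂noiseLaw m = 0 := fun j => by
    have := (h2 j).hasLaw.integral_eq
    simpa using this
  have i1 : Integrable (fun p : ℝ × (Fin m → ℝ) => p.1) (noiseLaw m) :=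
    h1.integrable_comp_of_integrable hid
  have i2 : ∀ j, Integrable (fun p : ℝ × (Fin m → ℝ) => p.2 j) (noiseLaw m) := fun j =>
    (h2 j).integrable_comp_of_integrable hid
  simp only [noiseForm]
  rw [integral_add (i1.const_mul b) (integrable_finsetSum _ fun j _ => (i2 j).const_mul (d j)),
    integral_finsetSum _ fun j _ => (i2 j).const_mul (d j)]
  simp [integral_const_mul, e1, e2]

theorem integral_noiseForm_sq (b : ℝ) (d : Fin m → ℝ) :
    ∫ p, noiseForm b d p ^ 2 ∂noiseLaw m = b ^ 2 + ∑ j, d j ^ 2 := by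
  have hv : ∀ c : ℝ, Var[fun x => c * x; gaussianReal 0 1] = c ^ 2 := fun c => by
    rw [variance_const_mul, variance_fun_id_gaussianReal]; simp
  have hLp : ∀ c : ℝ, MemLp (fun x => c * x) 2 (gaussianReal 0 1) := fun c =>
    (memLp_id_gaussianReal' 2 (by simp)).const_mul c
  have hsum : MemLp (fun z : Fin m → ℝ => ∑ j, d j * z j) 2
      (Measure.pi fun _ => gaussianReal 0 1) :=
    memLp_finsetSum _ fun j _ => (hLp (d j)).comp_measurePreserving
      (measurePreserving_eval (fun _ : Fin m => gaussianReal 0 1) j)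
  have hvpi : Var[fun z : Fin m → ℝ => ∑ j, d j * z j; Measure.pi fun _ => gaussianReal 0 1] =
      ∑ j, d j ^ 2 := by
    have := variance_sum_pi (μ := fun _ : Fin m => gaussianReal 0 1)
      (X := fun j x => d j * x) fun j => hLp (d j)
    simp only [hv] at this
    rw [← this]
    congr 1
    ext z
    simp
  -- The form is centred, so its second moment is its variance, which adds over the independent
  -- coordinates.
  have hvar : Var[noiseForm b d; noiseLaw m] = b ^ 2 + ∑ j, d j ^ 2 := by
    have hind : (fun p : ℝ × (Fin m → ℝ) => b * p.1) ⟂ᵢ[noiseLaw m]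
        (fun p : ℝ × (Fin m → ℝ) => ∑ j, d j * p.2 j) :=
      indepFun_prod (X := fun x : ℝ => b * x) (Y := fun z : Fin m → ℝ => ∑ j, d j * z j)
        (by fun_prop) (by fun_prop)
    have h1 : MeasurePreserving (fun p : ℝ × (Fin m → ℝ) => p.1) (noiseLaw m)
      (gaussianReal 0 1) := measurePreserving_fst
    have h2 : MeasurePreserving (fun p : ℝ × (Fin m → ℝ) => p.2) (noiseLaw m)
      (Measure.pi fun _ => gaussianReal 0 1) := measurePreserving_snd
    have := hind.variance_add ((hLp b).comp_measurePreserving h1)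
      (hsum.comp_measurePreserving h2)
    have v1 : Var[fun p : ℝ × (Fin m → ℝ) => b * p.1; noiseLaw m] = b ^ 2 := by
      rw [← hv b, ← h1.map_eq, variance_map (by fun_prop) (by fun_prop)]
      rfl
    have v2 : Var[fun p : ℝ × (Fin m → ℝ) => ∑ j, d j * p.2 j; noiseLaw m] = ∑ j, d j ^ 2 := by
      rw [← hvpi, ← h2.map_eq, variance_map
        (by fun_prop : Measurable fun z : Fin m → ℝ => ∑ j, d j * z j).aemeasurable
        h2.aemeasurable]
      rfl
    exact this.trans (congrArg₂ (· + ·) v1 v2)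
  rw [← hvar, variance_of_integral_eq_zero
    (memLp_noiseForm b d ENNReal.one_ne_top).aemeasurable (integral_noiseForm b d)]

theorem memLp_noiseForm_sq (b : ℝ) (d : Fin m → ℝ) :
    MemLp (fun p => noiseForm b d p ^ 2) 2 (noiseLaw m) := by
  -- Hölder with `1/4 + 1/4 = 1/2`: a product of two `L⁴` functions is in `L²`.
  have : ENNReal.HolderTriple 4 4 2 := ⟨by
    rw [← two_mul, show (4 : ℝ≥0∞) = 2 * 2 by norm_num,
      ENNReal.mul_inv (by simp) (by simp), ← mul_assoc, ENNReal.mul_inv_cancel (by simp) (by simp),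
      one_mul]⟩
  have h := memLp_noiseForm b d (by simp : (4 : ℝ≥0∞) ≠ ∞)
  simpa only [sq] using h.mul' h

/-- The quadratic form of the standardised indicators, as a combination of squares of linear forms
in the noise. -/
theorem marginalQuadratic_noise (c : Fin m → ℝ) (p : ℝ × (Fin m → ℝ)) :
    marginalQuadratic c (fun j => c j * p.1 + p.2 j) =
      ∑ j, noiseForm (c j) (Pi.single j 1) p ^ 2 -
        noiseForm (∑ j, c j ^ 2) c p ^ 2 / (1 + ∑ j, c j ^ 2) := by
  have h1 : ∀ j, noiseForm (c j) (Pi.single j 1) p = c j * p.1 + p.2 j := fun j => by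
    simp [noiseForm, Pi.single_apply]
  have h2 : noiseForm (∑ j, c j ^ 2) c p = ∑ j, c j * (c j * p.1 + p.2 j) := by
    simp only [noiseForm, Finset.sum_mul, ← Finset.sum_add_distrib]
    exact Finset.sum_congr rfl fun j _ => by ring
  simp_rw [marginalQuadratic, h1, h2]

theorem memLp_marginalQuadratic_noise (c : Fin m → ℝ) :
    MemLp (fun p : ℝ × (Fin m → ℝ) => marginalQuadratic c (fun j => c j * p.1 + p.2 j)) 2
      (noiseLaw m) := by
  simp_rw [marginalQuadratic_noise, div_eq_mul_inv]
  exact (memLp_finsetSum _ fun j _ => memLp_noiseForm_sq _ _).sub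
    ((memLp_noiseForm_sq _ _).mul_const _)

/-- The first sum contributes `m + |c|²`. The form `c·x = |c|²α + c·z` has second moment `|c|⁴ +
|c|² = |c|²(1 + |c|²)`, so the correction term removes exactly `|c|²`. -/
theorem integral_marginalQuadratic_noise (c : Fin m → ℝ) :
    ∫ p : ℝ × (Fin m → ℝ), marginalQuadratic c (fun j => c j * p.1 + p.2 j) ∂noiseLaw m = m := by
  have hi : ∀ b (d : Fin m → ℝ), Integrable (fun p => noiseForm b d p ^ 2) (noiseLaw m) :=
    fun b d => (memLp_noiseForm_sq b d).integrable one_le_two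
  have hs : 1 + ∑ j, c j ^ 2 ≠ 0 := by positivity
  simp_rw [marginalQuadratic_noise]
  rw [integral_sub (integrable_finsetSum _ fun j _ => hi _ _) ((hi _ _).div_const _),
    integral_finsetSum _ fun j _ => hi _ _, integral_div]
  simp_rw [integral_noiseForm_sq]
  have h1 : ∀ j : Fin m, ∑ i, (Pi.single j 1 : Fin m → ℝ) i ^ 2 = 1 := fun j => by
    simp [Pi.single_apply]
  simp_rw [h1, Finset.sum_add_distrib]
  simp only [Finset.sum_const, Finset.card_univ, Fintype.card_fin, nsmul_eq_mul]
  field_simp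
  ring

/-- The quadratic form vanishes at the origin but not at a coordinate vector, so it is not almost
surely constant. -/
theorem variance_marginalQuadratic_noise_ne_zero (hm : 1 ≤ m) (c : Fin m → ℝ) :
    Var[fun p : ℝ × (Fin m → ℝ) => marginalQuadratic c (fun j => c j * p.1 + p.2 j);
      noiseLaw m] ≠ 0 := by
  intro h
  have hcont : Continuous fun p : ℝ × (Fin m → ℝ) =>
      marginalQuadratic c (fun j => c j * p.1 + p.2 j) := by
    unfold marginalQuadratic; fun_prop
  have hae := ae_eq_integral_of_variance_eq_zero (memLp_marginalQuadratic_noise c) h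
  -- Full support upgrades almost sure equality of continuous functions to equality everywhere, so
  -- the form can be evaluated at single points.
  have heq := (hcont.ae_eq_iff_eq (noiseLaw m) continuous_const).1 hae
  let i : Fin m := ⟨0, hm⟩
  have h0 := congrFun heq (0, 0)
  have h1 := congrFun heq (0, Pi.single i 1)
  rw [← h0] at h1
  have hs : 0 < 1 + ∑ j, c j ^ 2 := by positivity
  -- At the coordinate vector the form equals `1 - c_i²/(1 + |c|²)`, which this bound makes
  -- positive.
  have hle : c i ^ 2 ≤ ∑ j, c j ^ 2 :=
    Finset.single_le_sum (f := fun j => c j ^ 2) (fun j _ => sq_nonneg _) (Finset.mem_univ i)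
  simp only [marginalQuadratic, Pi.single_apply, mul_zero, zero_add, mul_ite, mul_one,
    Finset.sum_ite_eq', Finset.mem_univ, if_true, Pi.zero_apply, ite_pow, one_pow, ne_eq,
    OfNat.ofNat_ne_zero, not_false_eq_true, zero_pow, Finset.sum_const_zero, zero_div,
    sub_zero] at h1
  rw [sub_eq_zero, eq_div_iff hs.ne'] at h1
  linarith

end Moments

/-! ### Transfer to the likelihood of the subjects -/

section Likelihood

variable {m : ℕ} {μ γ σ : Fin m → ℝ}

theorem measurable_nmll (hσ : ∀ j, 0 < σ j) : Measurable (nmll μ γ σ) := by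
  have : nmll μ γ σ = _ := funext (nmll_eq μ γ hσ)
  rw [this]
  unfold marginalQuadratic
  fun_prop

theorem nmll_indicators (hσ : ∀ j, 0 < σ j) (p : ℝ × (Fin m → ℝ)) :
    nmll μ γ σ (indicators μ γ σ p) = limitValue γ σ - (m : ℝ) / 2 +
      (1 / 2) * marginalQuadratic (fun j => γ j / σ j) (fun j => γ j / σ j * p.1 + p.2 j) := by
  have h : (fun j => (indicators μ γ σ p j - μ j) / σ j) = fun j => γ j / σ j * p.1 + p.2 j := by
    ext j
    have := (hσ j).ne'
    simp only [indicators]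
    field_simp
    ring
  rw [nmll_eq μ γ hσ, h]
  ring

theorem memLp_nmll_indicators (hσ : ∀ j, 0 < σ j) :
    MemLp (fun p => nmll μ γ σ (indicators μ γ σ p)) 2 (noiseLaw m) := by
  simp_rw [nmll_indicators hσ]
  exact (memLp_const (limitValue γ σ - (m : ℝ) / 2)).add
    ((memLp_marginalQuadratic_noise fun j => γ j / σ j).const_mul (1 / 2))

theorem integral_nmll_indicators (hσ : ∀ j, 0 < σ j) :
    ∫ p, nmll μ γ σ (indicators μ γ σ p) ∂noiseLaw m = limitValue γ σ := by
  have hi := (memLp_marginalQuadratic_noise fun j => γ j / σ j).integrable one_le_two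
  simp_rw [nmll_indicators hσ]
  rw [integral_add (integrable_const _) (hi.const_mul (1 / 2)), integral_const_mul,
    integral_marginalQuadratic_noise]
  simp
  ring

theorem variance_nmll_indicators_ne_zero (hm : 1 ≤ m) (hσ : ∀ j, 0 < σ j) :
    Var[fun p => nmll μ γ σ (indicators μ γ σ p); noiseLaw m] ≠ 0 := by
  have hLp := memLp_marginalQuadratic_noise fun j => γ j / σ j
  simp_rw [nmll_indicators hσ]
  rw [variance_const_add (hLp.const_mul (1 / 2)).aestronglyMeasurable, variance_const_mul]
  exact mul_ne_zero (by norm_num) (variance_marginalQuadratic_noise_ne_zero hm _)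

theorem IsSingleFactorModel.identDistrib_nmll {Ω : Type*} [MeasurableSpace Ω] {P : Measure Ω}
    [IsProbabilityMeasure P] {α : ℕ → Ω → ℝ} {Y : ℕ → Ω → Fin m → ℝ}
    (hmodel : IsSingleFactorModel P μ γ σ α Y) (hσ : ∀ j, 0 < σ j) (h : ℕ) :
    IdentDistrib (fun ω => nmll μ γ σ (Y h ω)) (fun p => nmll μ γ σ (indicators μ γ σ p))
      P (noiseLaw m) :=
  have hY : IdentDistrib (Y h) (indicators μ γ σ) P (noiseLaw m) :=
    ⟨(hmodel.hasCondDistrib h).aemeasurable_snd,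
      (measurable_indicators μ γ σ).aemeasurable, hmodel.map_eq h⟩
  hY.comp (measurable_nmll hσ)

theorem IsSingleFactorModel.iIndepFun_nmll {Ω : Type*} [MeasurableSpace Ω] {P : Measure Ω}
    {α : ℕ → Ω → ℝ} {Y : ℕ → Ω → Fin m → ℝ}
    (hmodel : IsSingleFactorModel P μ γ σ α Y) (hσ : ∀ j, 0 < σ j) :
    iIndepFun (fun h ω => nmll μ γ σ (Y h ω)) P :=
  hmodel.iIndepFun_subjects.comp (fun _ p => nmll μ γ σ p.2)
    fun _ => (measurable_nmll hσ).comp measurable_snd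

end Likelihood

end FactorModel

/-! ### Sample variance of an i.i.d. sequence -/

section IIDAverages

variable {Ω : Type*} [MeasurableSpace Ω] {P : Measure Ω} [IsProbabilityMeasure P]
  {X : ℕ → Ω → ℝ}

theorem sum_sq_sub_average (x : ℕ → ℝ) (H : ℕ) :
    (1 / (H : ℝ)) * ∑ h ∈ Finset.range H,
        (x h - (1 / (H : ℝ)) * ∑ k ∈ Finset.range H, x k) ^ 2 =
      (∑ h ∈ Finset.range H, x h ^ 2) / H - ((∑ h ∈ Finset.range H, x h) / H) ^ 2 := by
  rcases Nat.eq_zero_or_pos H with rfl | hH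
  · simp
  have hH' : (H : ℝ) ≠ 0 := by positivity
  simp_rw [sub_sq, Finset.sum_add_distrib, Finset.sum_sub_distrib, ← Finset.sum_mul,
    ← Finset.mul_sum, Finset.sum_const, Finset.card_range, nsmul_eq_mul]
  field_simp
  ring

/-- Strong consistency of the sample variance. -/
theorem ae_tendsto_sampleVariance (hX : MemLp (X 0) 2 P) (hindep : iIndepFun X P)
    (hident : ∀ i, IdentDistrib (X i) (X 0) P P) :
    ∀ᵐ ω ∂P, Tendsto (fun H : ℕ => (1 / (H : ℝ)) * ∑ h ∈ Finset.range H,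
        (X h ω - (1 / (H : ℝ)) * ∑ k ∈ Finset.range H, X k ω) ^ 2) atTop (𝓝 Var[X 0; P]) := by
  have h1 := strong_law_ae_real X (hX.integrable one_le_two)
    (fun i j hij => hindep.indepFun hij) hident
  -- The strong law needs only integrable squares, so no fourth moment of `X` is required.
  have h2 := strong_law_ae_real (fun i ω => X i ω ^ 2) hX.integrable_sq
    (fun i j hij => (hindep.indepFun hij).comp (φ := fun x : ℝ => x ^ 2) (ψ := fun x : ℝ => x ^ 2)
      (by fun_prop) (by fun_prop))
    (fun i => (hident i).comp (u := fun x : ℝ => x ^ 2) (by fun_prop))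
  filter_upwards [h1, h2] with ω hω1 hω2
  simp_rw [sum_sq_sub_average (fun h => X h ω), variance_eq_sub hX]
  exact hω2.sub (hω1.pow 2)

end IIDAverages

theorem theorem1 {Ω : Type*} [MeasurableSpace Ω] (P : Measure Ω) [IsProbabilityMeasure P]
    (m : ℕ) (hm : 1 ≤ m) (μ γ σ : Fin m → ℝ) (hσ : ∀ j, 0 < σ j)
    (α : ℕ → Ω → ℝ) (Y : ℕ → Ω → Fin m → ℝ)
    (hmodel : FactorModel.IsSingleFactorModel P μ γ σ α Y) :
    (∀ h, Integrable (fun ω => FactorModel.nmll μ γ σ (Y h ω)) P ∧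
      ∫ ω, FactorModel.nmll μ γ σ (Y h ω) ∂P = FactorModel.limitValue γ σ) ∧
    (∀ᵐ ω ∂P, Tendsto (fun H : ℕ => FactorModel.avgNmll μ γ σ Y H ω) atTop
      (𝓝 (FactorModel.limitValue γ σ))) ∧
    ∃ v : ℝ≥0, 0 < v ∧
      (∀ h, MemLp (fun ω => FactorModel.nmll μ γ σ (Y h ω)) 2 P ∧
        Var[fun ω => FactorModel.nmll μ γ σ (Y h ω); P] = v) ∧
      (∀ᵐ ω ∂P, Tendsto
        (fun H : ℕ => (1 / (H : ℝ)) * ∑ h ∈ Finset.range H,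
          (FactorModel.nmll μ γ σ (Y h ω) - FactorModel.avgNmll μ γ σ Y H ω) ^ 2)
        atTop (𝓝 (v : ℝ))) ∧
      TendstoInDistribution
        (fun (H : ℕ) ω => √(H : ℝ) *
          (FactorModel.avgNmll μ γ σ Y H ω - FactorModel.limitValue γ σ))
        atTop id (fun _ => P) (gaussianReal 0 v) := by
  have hlaw := hmodel.identDistrib_nmll hσ
  have hindep := hmodel.iIndepFun_nmll hσ
  have hident : ∀ h, IdentDistrib (fun ω => FactorModel.nmll μ γ σ (Y h ω))
      (fun ω => FactorModel.nmll μ γ σ (Y 0 ω)) P P := fun h => (hlaw h).trans (hlaw 0).symm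
  have hLp : ∀ h, MemLp (fun ω => FactorModel.nmll μ γ σ (Y h ω)) 2 P := fun h =>
    (hlaw h).memLp_iff.2 (FactorModel.memLp_nmll_indicators hσ)
  have hmean : ∀ h, ∫ ω, FactorModel.nmll μ γ σ (Y h ω) ∂P = FactorModel.limitValue γ σ :=
    fun h => (hlaw h).integral_eq.trans (FactorModel.integral_nmll_indicators hσ)
  have hvar : 0 < Var[fun ω => FactorModel.nmll μ γ σ (Y 0 ω); P] :=
    (variance_nonneg _ _).lt_of_ne' <| by
      rw [(hlaw 0).variance_eq]
      exact FactorModel.variance_nmll_indicators_ne_zero hm hσ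
  refine ⟨fun h => ⟨(hLp h).integrable one_le_two, hmean h⟩, ?_,
    Var[fun ω => FactorModel.nmll μ γ σ (Y 0 ω); P].toNNReal, Real.toNNReal_pos.2 hvar,
    fun h => ⟨hLp h, ?_⟩, ?_, ?_⟩
  · have hslln := strong_law_ae_real (fun h ω => FactorModel.nmll μ γ σ (Y h ω))
      ((hLp 0).integrable one_le_two) (fun i j hij => hindep.indepFun hij) hident
    filter_upwards [hslln] with ω hω
    rw [hmean 0] at hω
    simpa only [FactorModel.avgNmll, one_div_mul_eq_div] using hω
  · rw [(hident h).variance_eq, Real.coe_toNNReal _ hvar.le]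
  · rw [Real.coe_toNNReal _ hvar.le]
    exact ae_tendsto_sampleVariance (hLp 0) hindep hident
  · have hclt := tendstoInDistribution_inv_sqrt_mul_sum_sub
      (X := fun h ω => FactorModel.nmll μ γ σ (Y h ω)) HasLaw.id (hLp 0) hindep hident
    convert! hclt using 3 with H ω
    rw [hmean 0, FactorModel.avgNmll]
    -- For `H > 0` this is `√H (S/H - L) = (S - H L)/√H`, with `S` the sum of the first `H` terms;
    -- at `H = 0` both sides vanish because `√0 = 0`.
    rcases Nat.eq_zero_or_pos H with rfl | hH
    · simp
    have hH' : (0 : ℝ) < H := by exact_mod_cast hH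
    have hsq : √(H : ℝ) ^ 2 = H := Real.sq_sqrt hH'.le
    have hne : √(H : ℝ) ≠ 0 := by positivity
    field_simp
    rw [hsq]
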